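/- Let $\mathbb{F}$ be a field, let $n\ge 1$, and let $\mathrm{Mat}_n(\mathbb{F})$ be the algebra of $n\times n$ matrices over $\mathbb{F}$. For $S\subseteq\mathrm{Mat}_n(\mathbb{F})$, a word of length $k\ge 0$ in $S$ is a product $a_1\cdots a_k$ with $a_1,\dots,a_k\in S$ (the empty product, the identity matrix, is the word of length $0$), and the length $\ell(S)$ is the smallest integer $k\ge 0$ such that the $\mathbb{F}$-linear span of the words in $S$ of length at most $k$ equals the (unital) $\mathbb{F}$-algebra generated by $S$. Let $\ell(\mathrm{Mat}_n(\mathbb{F}))$ be the maximum of $\ell(S)$ over all subsets $S$ that generate $\mathrm{Mat}_n(\mathbb{F})$ as an $\mathbb{F}$-algebra. Then $\ell(S)$ is well defined for every $S\subseteq\mathrm{Mat}_n(\mathbb{F})$, and $$\ell(S)\le 2n\log_2 n+4n-4 .$$ In particular, the maximum $\ell(\mathrm{Mat}_n(\mathbb{F}))$ exists and is at most $2n\log_2 n+4n-4$; hence there is an absolute constant $C$, independent of $\mathbb{F}$ and $n$, such that $\ell(\mathrm{Mat}_n(\mathbb{F}))\le C\,n\log n$ for all fields $\mathbb{F}$ and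 all $n\ge 2$. -/

import Mathlib

universe u

namespace MatrixLength

variable (F : Type*) [Field F] {A : Type*} [Ring A] [Algebra F A]

/-- The set `S ^ k` of words of length `k` in `S`: the products `a₁ ⋯ aₖ` with all `aᵢ ∈ S`.
The empty product `1` is the only word of length `0`. -/
def words (S : Set A) (k : ℕ) : Set A :=
  {a | ∃ l : List A, l.length = k ∧ (∀ x ∈ l, x ∈ S) ∧ l.prod = a}

/-- The `F`-linear span of all the words in `S` that have length at most `k`. -/
def wordSpan (S : Set A) (k : ℕ) : Submodule F A :=
  Submodule.span F {a | ∃ j ≤ k, a ∈ words S j}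

/-- Those `k` for which the words of length at most `k` span the (unital) subalgebra
generated by `S`. -/
def spanningLengths (S : Set A) : Set ℕ :=
  {k | wordSpan F S k = Subalgebra.toSubmodule (Algebra.adjoin F S)}

/-- The length `ℓ(S)`: the smallest `k` such that the words in `S` of length at most `k` span
the subalgebra generated by `S`. -/
noncomputable def setLength (S : Set A) : ℕ :=
  sInf (spanningLengths F S)

variable (A) in
/-- The lengths of the subsets of `A` that generate `A` as an `F`-algebra. -/
def generatingLengths : Set ℕ :=
  {m | ∃ S : Set A, Algebra.adjoin F S = ⊤ ∧ setLength F S = m}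

variable (A) in
/-- The length `ℓ(A)`: the maximum of `ℓ(S)` over all the subsets `S` of `A` that generate `A`
as an `F`-algebra. -/
noncomputable def algLength : ℕ :=
  sSup (generatingLengths F A)

end MatrixLength

/-! Let `W` be the span of `1` and `S`. Words of length at most `k` span `W ^ k`, so the length is
the first `k` with `W ^ (k + 1) ≤ W ^ k`. Base change to the algebraic closure and gluing along
invariant subspaces reduce the bound to an irreducible action on a space of dimension `n` over an
algebraically closed field.

There it suffices to find an operator of rank one in a low power of `W`: multiplying it on both
sides by elements of `W ^ (n - 1)` gives all rank-one operators (`pow_eq_top_of_endRank_eq_one`).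
Starting from the identity, `exists_smaller_rank` lowers the rank `r` of an operator `A ∈ W ^ k`
without increasing the potential `k r + 2 n log₂ r`. This is `2 n log₂ n` at the start and equals
`k` at rank one.

To lower the rank, let `t` be the least length of an `x` for which `A x A` is not a multiple of `A`.
If `t r ≤ 3 n`, a polynomial of degree `d - 1` in `A x` divides the rank by at least `d`
(`exists_aeval_mul_endRank_le`). Otherwise `exists_gap` gives a short `D` such that `A y D A ≠ 0`
only for long `y`, and a shortest connecting word forces a small rank (`exists_mul_mul_endRank_le`).
-/

namespace MatrixLength

open Module Submodule

/-! ### Ranks, orbits and duality. -/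

section LinearAlgebra

variable {K V : Type*} [Field K] [AddCommGroup V] [Module K V]

/-- The rank of an endomorphism. -/
noncomputable def endRank (f : End K V) : ℕ := finrank K (LinearMap.range f)

/-- The subspace spanned by the vectors `x u` with `x ∈ L` and `u ∈ U`. -/
def orbitSpan (L : Submodule K (End K V)) (U : Submodule K V) : Submodule K V :=
  map₂ LinearMap.id L U

theorem apply_mem_orbitSpan {L : Submodule K (End K V)} {U : Submodule K V} {x : End K V} {u : V}
    (hx : x ∈ L) (hu : u ∈ U) : x u ∈ orbitSpan L U :=
  apply_mem_map₂ LinearMap.id hx hu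

theorem orbitSpan_le {L : Submodule K (End K V)} {U P : Submodule K V} :
    orbitSpan L U ≤ P ↔ ∀ x ∈ L, ∀ u ∈ U, x u ∈ P :=
  map₂_le

theorem orbitSpan_mono {L L' : Submodule K (End K V)} (h : L ≤ L') (U : Submodule K V) :
    orbitSpan L U ≤ orbitSpan L' U :=
  orbitSpan_le.2 fun _ hx _ hu => apply_mem_orbitSpan (h hx) hu

theorem orbitSpan_mul (L L' : Submodule K (End K V)) (U : Submodule K V) :
    orbitSpan (L * L') U = orbitSpan L (orbitSpan L' U) := by
  apply le_antisymm
  · refine orbitSpan_le.2 fun x hx u hu => ?_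
    induction hx using Submodule.mul_induction_on' with
    | mem_mul_mem a ha b hb =>
      exact apply_mem_orbitSpan (x := a) (u := b u) ha (apply_mem_orbitSpan hb hu)
    | add a _ b _ h1 h2 => exact add_mem h1 h2
  · refine orbitSpan_le.2 fun x hx u hu => ?_
    have : orbitSpan L' U ≤ (orbitSpan (L * L') U).comap x :=
      orbitSpan_le.2 fun y hy v hv => by
        exact apply_mem_orbitSpan (x := x * y) (mul_mem_mul hx hy) hv
    exact this hu

theorem finrank_ge_of_strict_chain [FiniteDimensional K V] (Y : ℕ → Submodule K V)
    (hmono : ∀ i, Y i ≤ Y (i + 1)) (m : ℕ) (hne : ∀ i < m, Y (i + 1) ≠ Y i) :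
    finrank K (Y 0) + m ≤ finrank K (Y m) := by
  induction m with
  | zero => simp
  | succ m ih =>
    have h1 := ih fun i hi => hne i (by omega)
    have h2 := finrank_lt_finrank_of_lt (lt_of_le_of_ne (hmono m) (hne m (by omega)).symm)
    omega

/-- Rank-nullity for `h` on `M`. The rank estimates below all count dimensions this way. -/
theorem finrank_add_le_of_map [FiniteDimensional K V] {L M R : Submodule K V} (h : End K V)
    (hLM : L ≤ M) (hL : ∀ v ∈ L, h v = 0) (hR : R ≤ M.map h) :
    finrank K L + finrank K R ≤ finrank K M := by
  have h1 := LinearMap.finrank_range_add_finrank_ker (h.domRestrict M)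
  rw [LinearMap.range_domRestrict, LinearMap.ker_domRestrict] at h1
  have h2 : finrank K R ≤ finrank K (M.map h) := finrank_mono hR
  have h3 : finrank K L ≤ finrank K (comap M.subtype (LinearMap.ker h)) := by
    rw [← LinearEquiv.finrank_eq (comapSubtypeEquivOfLe hLM)]
    exact finrank_mono fun x hx => hL _ hx
  omega

theorem endRank_pos [FiniteDimensional K V] {f : End K V} (hf : f ≠ 0) : 0 < endRank f := by
  rw [endRank, Nat.pos_iff_ne_zero, Ne, Submodule.finrank_eq_zero, LinearMap.range_eq_bot]
  exact hf

/-- By duality, the common kernel of `X ⊓ Z.dualAnnihilator` is the sum of `Z` and the common kernel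
of `X`. -/
theorem exists_sub_separated {E : Type*} [AddCommGroup E] [Module K E] [FiniteDimensional K E]
    (Z : Submodule K E) (X : Submodule K (Dual K E)) (e : E)
    (h : ∀ ξ ∈ X, (∀ z ∈ Z, ξ z = 0) → ξ e = 0) : ∃ z ∈ Z, ∀ ξ ∈ X, ξ (e - z) = 0 := by
  have h1 : e ∈ (X ⊓ Z.dualAnnihilator).dualCoannihilator := by
    rw [mem_dualCoannihilator]
    rintro ξ ⟨h1, h2⟩
    exact h ξ h1 ((mem_dualAnnihilator ξ).1 h2)
  rw [← Subspace.dualCoannihilator_dualAnnihilator_eq (W := X), ← dualAnnihilator_sup_eq,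
    Subspace.dualAnnihilator_dualCoannihilator_eq] at h1
  obtain ⟨x, hx, z, hz, rfl⟩ := mem_sup.1 h1
  refine ⟨z, hz, fun ξ hξ => ?_⟩
  rw [add_sub_cancel_right]
  exact (mem_dualCoannihilator x).1 hx ξ hξ

end LinearAlgebra

section Powers

variable {F A : Type*} [Field F] [Ring A] [Algebra F A] {W : Submodule F A}

theorem pow_mono_of_one_mem (h1 : (1 : A) ∈ W) {i j : ℕ} (h : i ≤ j) : W ^ i ≤ W ^ j :=
  pow_le_pow_right' (Submodule.one_le.2 h1) h

theorem pow_le_of_pow_succ_le (h1 : (1 : A) ∈ W) {k : ℕ} (h : W ^ (k + 1) ≤ W ^ k) (j : ℕ) :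
    W ^ j ≤ W ^ k := by
  induction j with
  | zero => exact pow_mono_of_one_mem h1 (Nat.zero_le _)
  | succ j ih =>
    calc W ^ (j + 1) = W ^ j * W := pow_succ _ _
      _ ≤ W ^ k * W := mul_le_mul_left ih W
      _ = W ^ (k + 1) := (pow_succ _ _).symm
      _ ≤ W ^ k := h

end Powers

/-! ### Connecting words for an irreducible action. -/

section Irreducible

variable {K V : Type*} [Field K] [AddCommGroup V] [Module K V]

/-- No proper nonzero subspace is invariant under all the operators in `W`. -/
def ActsIrreducibly (W : Submodule K (End K V)) : Prop :=
  ∀ U : Submodule K V, (∀ x ∈ W, ∀ u ∈ U, x u ∈ U) → U = ⊥ ∨ U = ⊤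

variable {W : Submodule K (End K V)}

theorem le_orbitSpan_pow (h1 : 1 ∈ W) (i : ℕ) (U : Submodule K V) : U ≤ orbitSpan (W ^ i) U :=
  fun u hu => by
    have h : (1 : End K V) ∈ W ^ i := Submodule.one_le.1 (one_le_pow_of_one_le' (Submodule.one_le.2 h1) i)
    exact apply_mem_orbitSpan h hu

variable [FiniteDimensional K V]

/-- A repetition in the increasing chain of orbits is an invariant subspace, hence everything. The
chain starts in dimension at least one, so `n` strict steps do not fit. -/
theorem orbitSpan_pow_eq_top (hW : ActsIrreducibly W) (h1 : 1 ∈ W) {U : Submodule K V}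
    (hU : U ≠ ⊥) : orbitSpan (W ^ (finrank K V - 1)) U = ⊤ := by
  set n := finrank K V
  by_contra hne
  have hmono : ∀ i j, i ≤ j → orbitSpan (W ^ i) U ≤ orbitSpan (W ^ j) U := fun i j hij =>
    orbitSpan_mono (pow_mono_of_one_mem h1 hij) U
  have hstrict : ∀ i < n, orbitSpan (W ^ (i + 1)) U ≠ orbitSpan (W ^ i) U := by
    intro i hi heq
    rcases hW (orbitSpan (W ^ i) U) (fun x hx u hu => by
      rw [← heq, pow_succ', orbitSpan_mul]
      exact apply_mem_orbitSpan hx hu) with h | h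
    · exact hU (le_bot_iff.1 ((le_orbitSpan_pow h1 i U).trans h.le))
    · exact hne (top_le_iff.1 (h.ge.trans (hmono _ _ (by omega))))
  have h := finrank_ge_of_strict_chain (fun i => orbitSpan (W ^ i) U)
    (fun i => hmono _ _ (Nat.le_succ i)) n hstrict
  have h2 : 0 < finrank K (orbitSpan (W ^ 0) U) := by
    rw [Nat.pos_iff_ne_zero, Ne, Submodule.finrank_eq_zero]
    exact fun h => hU (le_bot_iff.1 ((le_orbitSpan_pow h1 0 U).trans h.le))
  have h3 : finrank K (orbitSpan (W ^ n) U) ≤ n := Submodule.finrank_le _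
  omega

/-- Words with at most `dim V - 1` letters connect any two nonzero operators. -/
theorem exists_mul_mul_ne_zero (hW : ActsIrreducibly W) (h1 : 1 ∈ W) {A G : End K V}
    (hA : A ≠ 0) (hG : G ≠ 0) : ∃ x ∈ W ^ (finrank K V - 1), A * x * G ≠ 0 := by
  by_contra! h
  apply hA
  have htop := orbitSpan_pow_eq_top hW h1 (U := LinearMap.range G)
    (fun h => hG (LinearMap.range_eq_bot.1 h))
  have : (⊤ : Submodule K V) ≤ LinearMap.ker A := by
    rw [← htop]
    refine orbitSpan_le.2 ?_
    rintro x hx _ ⟨v, rfl⟩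
    exact LinearMap.congr_fun (h x hx) v
  exact LinearMap.ker_eq_top.1 (top_le_iff.1 this)

/-- If every such `A x A` were a multiple of `A`, then `A` would send the orbit of `A v`, which is
all of `V`, into the line of `A v`. -/
theorem exists_mul_mul_notMem_span (hW : ActsIrreducibly W) (h1 : 1 ∈ W) {A : End K V}
    (hA : 2 ≤ endRank A) : ∃ x ∈ W ^ (finrank K V - 1), A * x * A ∉ span K {A} := by
  by_contra! h
  obtain ⟨v, hv⟩ : ∃ v, A v ≠ 0 := by
    by_contra! h0
    have : A = 0 := LinearMap.ext h0
    rw [endRank, this, LinearMap.range_zero, finrank_bot] at hA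
    omega
  have htop := orbitSpan_pow_eq_top hW h1 (U := span K {A v}) (by simpa using hv)
  have hle : LinearMap.range A ≤ span K {A v} := by
    rw [LinearMap.range_eq_map, ← htop, map_le_iff_le_comap]
    refine orbitSpan_le.2 fun x hx u hu => ?_
    obtain ⟨c, rfl⟩ := mem_span_singleton.1 hu
    obtain ⟨d, hd⟩ := mem_span_singleton.1 (h x hx)
    rw [mem_comap, map_smul, map_smul]
    refine smul_mem _ _ (mem_span_singleton.2 ⟨d, ?_⟩)
    exact LinearMap.congr_fun hd v
  have := finrank_mono hle
  have h2 := finrank_span_singleton (K := K) hv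
  rw [endRank] at hA
  omega

open scoped Pointwise in
/-- If `t` is the least length of a word `w` with `A w G ≠ 0`, then some
such `A w G` has rank at most `dim V / (t + 1)`. -/
theorem exists_mul_mul_endRank_le {A G : End K V} (h1 : 1 ∈ W) {t : ℕ}
    (hlt : ∀ j < t, ∀ x ∈ W ^ j, A * x * G = 0) (hex : ∃ x ∈ W ^ t, A * x * G ≠ 0) :
    ∃ w ∈ W ^ t, A * w * G ≠ 0 ∧ (t + 1) * endRank (A * w * G) ≤ finrank K V := by
  -- A single product of `t` elements of `W` is needed, not a sum, because `w` is cut into two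
  -- factors below.
  obtain ⟨w, hw, hne⟩ : ∃ w ∈ (W : Set (End K V)) ^ t, A * w * G ≠ 0 := by
    by_contra! h
    obtain ⟨x, hx, hne⟩ := hex
    rw [pow_eq_span_pow_set] at hx
    apply hne
    clear hne
    induction hx using span_induction with
    | mem x hx => exact h x hx
    | zero => simp
    | add x y _ _ hx hy => rw [mul_add, add_mul, hx, hy, add_zero]
    | smul c x _ hx => rw [mul_smul_comm, smul_mul_assoc, hx, smul_zero]
  have hsub : ∀ i, ∀ x ∈ (W : Set (End K V)) ^ i, x ∈ W ^ i := fun i x hx => by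
    rw [pow_eq_span_pow_set]
    exact subset_span hx
  refine ⟨w, hsub t w hw, hne, ?_⟩
  have factor : ∀ i ≤ t, ∃ p ∈ W ^ (t - i), LinearMap.range (A * w * G) ≤
      (orbitSpan (W ^ i) (LinearMap.range G)).map (A * p) := by
    intro i hi
    rw [← Nat.sub_add_cancel hi, pow_add] at hw
    obtain ⟨p, hp, q, hq, hpq⟩ := Set.mem_mul.1 hw
    refine ⟨p, hsub _ p hp, ?_⟩
    rintro _ ⟨v, rfl⟩
    refine ⟨q (G v), apply_mem_orbitSpan (hsub i q hq) ⟨v, rfl⟩, ?_⟩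
    rw [← hpq]
    rfl
  -- By minimality of `t`, the left factor of length `t - (i + 1)`, followed by `A`, kills the orbit
  -- of index `i`. It maps the next orbit onto a space containing the range of `A w G`, so each step
  -- gains that rank.
  have key : ∀ i ≤ t, (i + 1) * endRank (A * w * G) ≤
      finrank K (orbitSpan (W ^ i) (LinearMap.range G)) := by
    intro i hi
    obtain ⟨p, hp, hrange⟩ := factor i hi
    induction i generalizing p with
    | zero =>
      have := finrank_mono hrange
      have h2 := finrank_map_le (A * p) (orbitSpan (W ^ 0) (LinearMap.range G))
      rw [endRank]
      omega
    | succ i ih =>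
      obtain ⟨p', hp', hrange'⟩ := factor i (by omega)
      have ih' := ih (by omega) p' hp' hrange'
      have hker : orbitSpan (W ^ i) (LinearMap.range G) ≤ LinearMap.ker (A * p) := by
        refine orbitSpan_le.2 ?_
        rintro x hx _ ⟨v, rfl⟩
        have hpx : p * x ∈ W ^ (t - (i + 1) + i) := by
          rw [pow_add]
          exact mul_mem_mul hp hx
        exact LinearMap.congr_fun (hlt _ (by omega) _ hpx) v
      have h := finrank_add_le_of_map (A * p)
        (orbitSpan_mono (pow_mono_of_one_mem h1 (Nat.le_succ i)) (LinearMap.range G))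
        (fun v hv => hker hv) hrange
      rw [endRank] at *
      rw [add_mul (i + 1), one_mul]
      exact (Nat.add_le_add_right ih' _).trans h
  exact (key t le_rfl).trans (Submodule.finrank_le _)

end Irreducible

end MatrixLength

namespace MatrixLength

open Module Submodule

/-! ### Lowering the rank by polynomials in `A x`. -/

section Polynomials

open Polynomial

variable {K V : Type*} [Field K] [AddCommGroup V] [Module K V]

/-- Lets extra polynomial factors act on the right of `A`, where they can only shrink the range. -/
theorem mul_aeval_mul_comm {F A : Type*} [Field F] [Ring A] [Algebra F A] (a x : A) (p : F[X]) :
    a * aeval (x * a) p = aeval (a * x) p * a := by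
  induction p using Polynomial.induction_on' with
  | add p q hp hq => rw [map_add, map_add, mul_add, add_mul, hp, hq]
  | monomial n c =>
    have h : a * (x * a) ^ n = (a * x) ^ n * a := by
      induction n with
      | zero => simp
      | succ n ih => rw [pow_succ, ← mul_assoc, ih, pow_succ]; simp only [mul_assoc]
    rw [aeval_monomial, aeval_monomial, ← mul_assoc, ← Algebra.commutes, mul_assoc, h, mul_assoc]

theorem endRank_le_of_range_le [FiniteDimensional K V] {f g : End K V}
    (h : LinearMap.range f ≤ LinearMap.range g) : endRank f ≤ endRank g :=
  finrank_mono h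

/-- If `A x` is not a scalar on the range of `A`, and its minimal polynomial there has degree `d`,
then a polynomial in `A x` of degree `d - 1` is nonzero on this range and has rank at most
`rank A / d`. -/
theorem exists_aeval_mul_endRank_le [FiniteDimensional K V] [IsAlgClosed K] {A x : End K V}
    (hx : A * x * A ∉ span K {A}) : ∃ d, 2 ≤ d ∧ ∃ q : K[X], q.natDegree + 1 = d ∧
      aeval (A * x) q * A ≠ 0 ∧ d * endRank (aeval (A * x) q * A) ≤ endRank A := by
  classical
  have hex : ∃ d, ∃ m : K[X], m ≠ 0 ∧ m.natDegree = d ∧ aeval (A * x) m * A = 0 :=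
    ⟨_, minpoly K (A * x), minpoly.ne_zero (Algebra.IsIntegral.isIntegral _), rfl, by
      rw [minpoly.aeval, zero_mul]⟩
  obtain ⟨m, hm0, hmd, hm⟩ := Nat.find_spec hex
  set d := Nat.find hex with hd
  have hmin : ∀ q : K[X], q ≠ 0 → q.natDegree < d → aeval (A * x) q * A ≠ 0 :=
    fun q hq hlt h => Nat.find_min hex hlt ⟨q, hq, rfl, h⟩
  have hA : A ≠ 0 := by
    rintro rfl
    simp at hx
  have hd2 : 2 ≤ d := by
    by_contra! hlt
    have h1 : m.natDegree ≤ 1 := by omega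
    rw [Polynomial.eq_X_add_C_of_natDegree_le_one h1] at hm
    simp only [map_add, map_mul, aeval_C, aeval_X, add_mul] at hm
    have h2 : m.coeff 1 • (A * x * A) + m.coeff 0 • A = 0 := by
      rw [← hm, Algebra.smul_def, Algebra.smul_def, mul_assoc, mul_assoc, mul_assoc]
    by_cases h3 : m.coeff 1 = 0
    · rw [h3, zero_smul, zero_add] at h2
      rcases smul_eq_zero.1 h2 with h4 | h4
      · apply hm0
        rw [Polynomial.eq_X_add_C_of_natDegree_le_one h1, h3, h4]
        simp
      · exact hA h4
    · apply hx
      refine mem_span_singleton.2 ⟨-((m.coeff 1)⁻¹ * m.coeff 0), ?_⟩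
      have h5 : m.coeff 1 • (A * x * A) = -(m.coeff 0 • A) := eq_neg_of_add_eq_zero_left h2
      rw [neg_smul, mul_smul, ← smul_neg, ← h5, inv_smul_smul₀ h3]
  refine ⟨d, hd2, ?_⟩
  by_contra! hcon
  set r := endRank A with hr
  have hc : ∀ q : K[X], q.natDegree + 1 = d → r / d + 1 ≤ endRank (aeval (A * x) q * A) := by
    intro q hq
    have hq0 : q ≠ 0 := by
      rintro rfl
      simp at hq
      omega
    have := hcon q hq (hmin q hq0 (by omega))
    exact (Nat.div_lt_iff_lt_mul (by omega)).2 (by rwa [mul_comm])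
  -- Build `m` root by root. The factor `X - C a` kills the range belonging to `m / (X - C a)`,
  -- whose dimension is at least `r / d + 1` by assumption. The `d` factors together would cost more
  -- than `r`.
  have key : ∀ N : ℕ, ∀ p : K[X], p.natDegree = N → p ∣ m →
      endRank (aeval (A * x) p * A) + (r / d + 1) * N ≤ r := by
    intro N
    induction N with
    | zero =>
      intro p hp _
      rw [mul_zero, add_zero, Polynomial.eq_C_of_natDegree_eq_zero hp, aeval_C,
        Algebra.commutes]
      exact endRank_le_of_range_le (LinearMap.range_comp_le_range _ A)
    | succ N ih =>
      intro p hp hpm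
      have hp0 : p ≠ 0 := by
        rintro rfl
        simp at hp
      obtain ⟨a, ha⟩ := IsAlgClosed.exists_root p (by
        rw [Polynomial.degree_eq_natDegree hp0, hp]
        exact_mod_cast Nat.succ_ne_zero N)
      obtain ⟨p₁, rfl⟩ := Polynomial.dvd_iff_isRoot.2 ha
      obtain ⟨s, hs⟩ := hpm
      have hp₁ : p₁ ≠ 0 := right_ne_zero_of_mul hp0
      have hX : (X - C a) ≠ 0 := left_ne_zero_of_mul hp0
      have hs0 : s ≠ 0 := by
        rintro rfl
        exact hm0 (by rw [hs, mul_zero])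
      have hdeg1 : p₁.natDegree = N := by
        rw [Polynomial.natDegree_mul hX hp₁, natDegree_X_sub_C] at hp
        omega
      have hq : (p₁ * s).natDegree + 1 = d := by
        rw [← hmd, hs, mul_assoc, Polynomial.natDegree_mul hX (mul_ne_zero hp₁ hs0),
          natDegree_X_sub_C, add_comm]
      have h1 := ih p₁ hdeg1 ((dvd_mul_left p₁ _).trans ⟨s, hs⟩)
      have h2 := hc _ hq
      have h3 := finrank_add_le_of_map (L := LinearMap.range (aeval (A * x) (p₁ * s) * A))
        (M := LinearMap.range (aeval (A * x) p₁ * A))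
        (R := LinearMap.range (aeval (A * x) ((X - C a) * p₁) * A)) (aeval (A * x) (X - C a))
        (by
          rw [map_mul, mul_assoc, ← mul_aeval_mul_comm, ← mul_assoc]
          exact LinearMap.range_comp_le_range _ _)
        (by
          rintro _ ⟨v, rfl⟩
          have : aeval (A * x) (X - C a) * (aeval (A * x) (p₁ * s) * A) = 0 := by
            rw [← mul_assoc, ← map_mul, ← mul_assoc, ← hs, hm]
          exact LinearMap.congr_fun this v)
        (by
          rw [map_mul, mul_assoc]
          exact (LinearMap.range_comp _ _).le)
      rw [endRank] at *
      rw [mul_add, mul_one]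
      omega
  have h1 := key d m hmd dvd_rfl
  have h2 := Nat.lt_div_mul_add (a := r) (b := d) (by omega)
  rw [add_mul, one_mul] at h1
  omega

theorem aeval_mul_mem_pow {F A : Type*} [Field F] [Ring A] [Algebra F A] {W : Submodule F A}
    (h1 : (1 : A) ∈ W) {k t d : ℕ} {a x : A} (ha : a ∈ W ^ k) (hx : x ∈ W ^ t) {q : F[X]}
    (hq : q.natDegree ≤ d) : aeval (a * x) q * a ∈ W ^ (d * (k + t) + k) := by
  rw [aeval_eq_sum_range, Finset.sum_mul]
  refine sum_mem fun i hi => ?_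
  rw [smul_mul_assoc]
  refine smul_mem _ _ (pow_mono_of_one_mem h1 (i := i * (k + t) + k) ?_ ?_)
  · have : i ≤ d := by
      rw [Finset.mem_range] at hi
      omega
    gcongr
  · rw [pow_add, mul_comm i, pow_mul]
    refine mul_mem_mul (pow_mem_pow _ ?_ i) ha
    rw [pow_add]
    exact mul_mem_mul ha hx

end Polynomials

/-! ### Gaps between an operator and its translates. -/

section Gap

variable {K V : Type*} [Field K] [AddCommGroup V] [Module K V] [FiniteDimensional K V]
  {W : Submodule K (End K V)}

/-- If words `x` shorter than `t` act through `A x A` as scalars and `t` is large, then some short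
word combination `D` satisfies `D A ≠ 0` and `A C D A = 0` for all `C` of total length below `t`. -/
theorem exists_gap (h1 : 1 ∈ W) {A : End K V} (hA : A ≠ 0) {t : ℕ}
    (hlt : ∀ j < t, ∀ x ∈ W ^ j, A * x * A ∈ span K {A})
    (hex : ∃ x ∈ W ^ t, A * x * A ∉ span K {A}) (ht : finrank K V < t * endRank A) :
    ∃ b < t, b * endRank A ≤ finrank K V ∧ ∃ D ∈ W ^ b, D * A ≠ 0 ∧
      ∀ j, b + j < t → ∀ C ∈ W ^ j, A * C * (D * A) = 0 := by
  by_contra! hcon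
  obtain ⟨v, hv⟩ : ∃ v, A v ≠ 0 := by
    by_contra! h0
    exact hA (LinearMap.ext h0)
  obtain ⟨ψ, hψ⟩ := Projective.exists_dual_eq_one K hv
  have hr : 0 < endRank A := endRank_pos hA
  have hspan : ∀ y ∈ span K {A}, ψ (y v) • A = y := by
    intro y hy
    obtain ⟨c, rfl⟩ := mem_span_singleton.1 hy
    rw [LinearMap.smul_apply, map_smul, hψ, smul_eq_mul, mul_one]
  have hbt : finrank K V / endRank A < t := (Nat.div_lt_iff_lt_mul hr).2 ht
  -- Without a gap every orbit gains `endRank A` dimensions, which at the last index exceeds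
  -- `finrank K V`.
  have key : ∀ i ≤ finrank K V / endRank A,
      (i + 1) * endRank A ≤ finrank K (orbitSpan (W ^ i) (LinearMap.range A)) := by
    intro i
    induction i with
    | zero =>
      intro _
      rw [zero_add, one_mul]
      exact finrank_mono (le_orbitSpan_pow h1 0 _)
    | succ i ih =>
      intro hi
      -- Otherwise every `W ^ j * span K {A}` lies in the one for `i`, so `x A = z A` with `z ∈ W ^
      -- i` and `i < t`, making `A x A` a multiple of `A`.
      obtain ⟨B, hB, hBZ⟩ : ∃ B ∈ W ^ (i + 1), B * A ∉ W ^ i * span K {A} := by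
        by_contra! h
        have hstep : W ^ (i + 1) * span K {A} ≤ W ^ i * span K {A} := by
          intro y hy
          obtain ⟨z, hz, rfl⟩ := mem_mul_span_singleton.1 hy
          exact h z hz
        have hall : ∀ j, W ^ j * span K {A} ≤ W ^ i * span K {A} := by
          intro j
          induction j with
          | zero => exact mul_le_mul_left (pow_mono_of_one_mem h1 (Nat.zero_le i)) _
          | succ j ihj =>
            calc W ^ (j + 1) * span K {A} = W * (W ^ j * span K {A}) := by rw [pow_succ', mul_assoc]
              _ ≤ W * (W ^ i * span K {A}) := mul_le_mul_right ihj _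
              _ = W ^ (i + 1) * span K {A} := by rw [pow_succ', mul_assoc]
              _ ≤ _ := hstep
        obtain ⟨x, hx, hxA⟩ := hex
        obtain ⟨z, hz, hzA⟩ := mem_mul_span_singleton.1
          (hall t (mul_mem_mul hx (mem_span_singleton_self A)))
        apply hxA
        rw [mul_assoc, ← hzA, ← mul_assoc]
        exact hlt i (by omega) z hz
      -- For `C` and `z` of total length below `t`, `A C z A` is a multiple of `A`; the scalar is `Φ
      -- C (z * A)`.
      let Φ : End K V →ₗ[K] Dual K (End K V) :=
        LinearMap.mk₂ K (fun C z => ψ ((A * C * z) v))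
          (fun a b c => by simp [mul_add, add_mul]) (fun a b c => by simp)
          (fun a b c => by simp [mul_add]) (fun a b c => by simp)
      have hΦ : ∀ C z, Φ C z = ψ ((A * C * z) v) := fun C z => rfl
      -- If no such `C` exists, duality corrects `B` by some `B' ∈ W ^ i` so that `B - B'` is a gap
      -- of length `i + 1`.
      obtain ⟨C, hC, hC0, hCB⟩ : ∃ C ∈ W ^ (t - 1 - (i + 1)),
          (∀ z ∈ W ^ i * span K {A}, Φ C z = 0) ∧ Φ C (B * A) ≠ 0 := by
        by_contra! h
        obtain ⟨z, hz, hzX⟩ := exists_sub_separated (W ^ i * span K {A})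
          ((W ^ (t - 1 - (i + 1))).map Φ) (B * A) (by
            rintro _ ⟨C, hC, rfl⟩ h0
            exact h C hC h0)
        obtain ⟨B', hB', rfl⟩ := mem_mul_span_singleton.1 hz
        have hD : B - B' ∈ W ^ (i + 1) := sub_mem hB (pow_mono_of_one_mem h1 (Nat.le_succ i) hB')
        have hDA : (B - B') * A ≠ 0 := by
          intro h0
          rw [sub_mul, sub_eq_zero] at h0
          rw [h0] at hBZ
          exact hBZ hz
        obtain ⟨j, hj, C, hC, hne⟩ := hcon (i + 1) (by omega)
          ((Nat.mul_le_mul_right _ hi).trans (Nat.div_mul_le_self _ _)) _ hD hDA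
        apply hne
        have h2 := hzX (Φ C) ⟨C, pow_mono_of_one_mem h1 (by omega) hC, rfl⟩
        have h3 : C * (B - B') ∈ W ^ (j + (i + 1)) := by
          rw [pow_add]
          exact mul_mem_mul hC hD
        have h4 := hspan _ (hlt _ (by omega) _ h3)
        rw [← sub_mul, hΦ] at h2
        simp only [← mul_assoc] at h2 h4 ⊢
        rw [← h4, h2, zero_smul]
      have hscal : ∀ z ∈ W ^ (i + 1), A * C * (z * A) = Φ C (z * A) • A := by
        intro z hz
        have h3 : C * z ∈ W ^ (t - 1 - (i + 1) + (i + 1)) := by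
          rw [pow_add]
          exact mul_mem_mul hC hz
        have h4 := hspan _ (hlt _ (by omega) _ h3)
        rw [hΦ]
        simp only [← mul_assoc] at h4 ⊢
        exact h4.symm
      have hker : orbitSpan (W ^ i) (LinearMap.range A) ≤ LinearMap.ker (A * C) := by
        refine orbitSpan_le.2 ?_
        rintro z hz _ ⟨u, rfl⟩
        have h2 := hscal z (pow_mono_of_one_mem h1 (Nat.le_succ i) hz)
        rw [hC0 _ (mul_mem_mul hz (mem_span_singleton_self A)), zero_smul] at h2
        exact LinearMap.congr_fun h2 u
      have h := finrank_add_le_of_map (A * C)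
        (orbitSpan_mono (pow_mono_of_one_mem h1 (Nat.le_succ i)) (LinearMap.range A))
        (fun v hv => hker hv) (R := LinearMap.range A) (by
          rintro _ ⟨u, rfl⟩
          refine ⟨B (A ((Φ C (B * A))⁻¹ • u)), apply_mem_orbitSpan hB ⟨_, rfl⟩, ?_⟩
          have h2 := LinearMap.congr_fun (hscal B hB) ((Φ C (B * A))⁻¹ • u)
          rw [LinearMap.smul_apply, map_smul A, smul_inv_smul₀ hCB] at h2
          exact h2)
      have ih' := ih (by omega)
      rw [add_mul (i + 1), one_mul]
      exact (Nat.add_le_add_right ih' _).trans h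
  have h2 := (key _ le_rfl).trans (Submodule.finrank_le _)
  have h3 := Nat.lt_div_mul_add (a := finrank K V) hr
  rw [add_mul, one_mul] at h2
  omega

end Gap

/-! ### Descent to rank one. -/

section RankOne

variable {K V : Type*} [Field K] [AddCommGroup V] [Module K V] [FiniteDimensional K V]
  {W : Submodule K (End K V)}

/-- A drop of `c` in `log₂` of the rank pays for a growth of `2 n c` in length times rank. -/
theorem potential_le_of_logb_le {r r' k n k' : ℕ} {c : ℝ} (hk : ((k' * r' : ℕ) : ℝ) ≤ k * r + 2 * n * c)
    (hc : c ≤ Real.logb 2 r - Real.logb 2 r') :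
    (k' : ℝ) * r' + 2 * n * Real.logb 2 r' ≤ k * r + 2 * n * Real.logb 2 r := by
  push_cast at hk
  have : (0 : ℝ) ≤ 2 * n := by positivity
  nlinarith [mul_le_mul_of_nonneg_left hc this]

theorem one_le_logb_sub {r r' d : ℕ} {c : ℝ} (hr' : 0 < r') (hd : (2 : ℝ) ^ c ≤ d)
    (h : d * r' ≤ r) : c ≤ Real.logb 2 r - Real.logb 2 r' := by
  have h0 : (0 : ℝ) < d := lt_of_lt_of_le (by positivity) hd
  have h1 : (0 : ℝ) < r' := by exact_mod_cast hr'
  have h2 : (d : ℝ) * r' ≤ r := by exact_mod_cast h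
  have h3 : (0 : ℝ) < r := lt_of_lt_of_le (by positivity) h2
  rw [← Real.logb_div h3.ne' h1.ne', Real.le_logb_iff_rpow_le (by norm_num) (by positivity)]
  exact hd.trans ((le_div_iff₀ h1).2 h2)

/-- Passing from a nonzero operator of rank `r ≥ 2` to one of smaller rank. -/
theorem exists_smaller_rank [IsAlgClosed K] (hW : ActsIrreducibly W) (h1 : 1 ∈ W) {k : ℕ}
    {A : End K V} (hA : A ∈ W ^ k) (hr : 2 ≤ endRank A) :
    ∃ k' : ℕ, ∃ A' ∈ W ^ k', A' ≠ 0 ∧ endRank A' < endRank A ∧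
      (k' : ℝ) * endRank A' + 2 * finrank K V * Real.logb 2 (endRank A') ≤
        k * endRank A + 2 * finrank K V * Real.logb 2 (endRank A) := by
  classical
  have hA0 : A ≠ 0 := by
    rintro rfl
    rw [endRank, LinearMap.range_zero, finrank_bot] at hr
    omega
  have hext : ∃ t, ∃ x ∈ W ^ t, A * x * A ∉ span K {A} :=
    ⟨_, exists_mul_mul_notMem_span hW h1 hr⟩
  obtain ⟨x, hx, hxA⟩ := Nat.find_spec hext
  have hlt : ∀ j < Nat.find hext, ∀ x ∈ W ^ j, A * x * A ∈ span K {A} := by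
    intro j hj
    have := Nat.find_min hext hj
    push Not at this
    exact this
  set t := Nat.find hext
  set n := finrank K V
  set r := endRank A
  -- The threshold leaves more than `2 n` in the second case once the gap has used at most `n`, and
  -- stays affordable in the first.
  by_cases htr : t * r ≤ 3 * n
  · obtain ⟨d, hd, q, hq, hne, hrank⟩ := exists_aeval_mul_endRank_le hxA
    have hpos := endRank_pos hne
    set r' := endRank (Polynomial.aeval (A * x) q * A)
    refine ⟨_, _, aeval_mul_mem_pow h1 hA hx le_rfl, hne, by nlinarith, ?_⟩
    obtain ⟨e, rfl⟩ : ∃ e, d = e + 2 := ⟨d - 2, by omega⟩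
    have hqe : q.natDegree = e + 1 := by omega
    have hkr : (e + 2) * r' * k ≤ r * k := Nat.mul_le_mul_right k hrank
    have htr' : (e + 2) * r' * t ≤ 3 * n := (Nat.mul_le_mul_right t hrank).trans (by linarith)
    -- For `d = 2` the growth is at most `2 n`, paid by `log₂ 2 = 1`. For `d ≥ 3` it is at most `3
    -- n`, paid by `log₂ 3 ≥ 3 / 2`.
    rcases Nat.eq_zero_or_pos e with he | he
    · refine potential_le_of_logb_le (c := 1) ?_
        (one_le_logb_sub hpos (d := 2) (by norm_num) (by nlinarith))
      subst he
      rw [hqe]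
      have : ((0 + 1) * (k + t) + k) * r' ≤ k * r + 2 * n := by nlinarith
      exact_mod_cast (by simpa using this)
    · refine potential_le_of_logb_le (c := 3 / 2) ?_
        (one_le_logb_sub hpos (d := 3) ?_ (by nlinarith))
      · rw [hqe]
        have : ((e + 1) * (k + t) + k) * r' ≤ k * r + 3 * n := by nlinarith
        have h2 : ((((e + 1) * (k + t) + k) * r' : ℕ) : ℝ) ≤ k * r + 3 * n := by exact_mod_cast this
        linarith
      · rw [show (3 / 2 : ℝ) = 1 + 1 / 2 by norm_num, Real.rpow_add (by norm_num), Real.rpow_one,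
          ← Real.sqrt_eq_rpow]
        have : Real.sqrt 2 ≤ 3 / 2 := Real.sqrt_le_iff.2 ⟨by norm_num, by norm_num⟩
        push_cast
        linarith
  · push Not at htr
    obtain ⟨b, hbt, hbn, D, hD, hDA, hgap⟩ := exists_gap h1 hA0 hlt ⟨x, hx, hxA⟩ (by
      change n < t * r
      omega)
    have hexs : ∃ s, ∃ y ∈ W ^ s, A * y * (D * A) ≠ 0 :=
      ⟨_, exists_mul_mul_ne_zero hW h1 hA0 hDA⟩
    have hs := Nat.find_spec hexs
    have hslt : ∀ j < Nat.find hexs, ∀ y ∈ W ^ j, A * y * (D * A) = 0 := by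
      intro j hj
      have := Nat.find_min hexs hj
      push Not at this
      exact this
    set s := Nat.find hexs
    have hst : t ≤ b + s := by
      by_contra! h
      obtain ⟨y, hy, hne⟩ := hs
      exact hne (hgap s h y hy)
    obtain ⟨w, hw, hne, hrank⟩ := exists_mul_mul_endRank_le h1 hslt hs
    have hpos := endRank_pos hne
    have hmem : A * w * (D * A) ∈ W ^ (k + s + (b + k)) := by
      rw [pow_add, pow_add W k, pow_add W b]
      exact mul_mem_mul (mul_mem_mul hA hw) (mul_mem_mul hD hA)
    set r' := endRank (A * w * (D * A))
    change (s + 1) * r' ≤ n at hrank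
    change b * r ≤ n at hbn
    -- From `3 n < t r ≤ (b + s) r` and `b r ≤ n`; against `(s + 1) r' ≤ n` this halves the rank.
    have h2n : 2 * n < (s + 1) * r := by
      have : t * r ≤ (b + s) * r := Nat.mul_le_mul_right r hst
      nlinarith
    have hhalf : 2 * r' ≤ r := by
      have : (s + 1) * (2 * r') ≤ (s + 1) * r := by nlinarith
      exact Nat.le_of_mul_le_mul_left this (Nat.succ_pos s)
    refine ⟨_, _, hmem, hne, by omega, ?_⟩
    refine potential_le_of_logb_le (c := 1) ?_
        (one_le_logb_sub hpos (d := 2) (by norm_num) hhalf)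
    have : (k + s + (b + k)) * r' ≤ k * r + 2 * n := by
      have e1 : k * (2 * r') ≤ k * r := Nat.mul_le_mul_left k hhalf
      have e2 : b * (2 * r') ≤ b * r := Nat.mul_le_mul_left b hhalf
      nlinarith
    exact_mod_cast (by simpa using this)

theorem exists_endRank_eq_one [IsAlgClosed K] (hW : ActsIrreducibly W) (h1 : 1 ∈ W) {k : ℕ}
    {A : End K V} (hA : A ∈ W ^ k) (hA0 : A ≠ 0) :
    ∃ k' : ℕ, ∃ A' ∈ W ^ k', endRank A' = 1 ∧
      (k' : ℝ) ≤ k * endRank A + 2 * finrank K V * Real.logb 2 (endRank A) := by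
  induction hr : endRank A using Nat.strong_induction_on generalizing A k with
  | _ r ih =>
    subst hr
    rcases lt_or_ge (endRank A) 2 with h | h
    · have hone : endRank A = 1 := by
        have := endRank_pos hA0
        omega
      exact ⟨k, A, hA, hone, by rw [hone]; simp⟩
    · obtain ⟨k₁, A₁, hA₁, hne, hlt, hle⟩ := exists_smaller_rank hW h1 hA h
      obtain ⟨k', A', hA', hone, hle'⟩ := ih _ hlt hA₁ hne rfl
      exact ⟨k', A', hA', hone, hle'.trans hle⟩

/-- In `z A x`, the factor `z` moves the image line of `A` to any vector and `x` turns its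
functional into any functional. -/
theorem pow_eq_top_of_endRank_eq_one (hW : ActsIrreducibly W) (h1 : 1 ∈ W) {k : ℕ}
    {A : End K V} (hA : A ∈ W ^ k) (hr : endRank A = 1) :
    W ^ (finrank K V - 1 + k + (finrank K V - 1)) = ⊤ := by
  set m := finrank K V - 1
  have hA0 : A ≠ 0 := by
    rintro rfl
    rw [endRank, LinearMap.range_zero, finrank_bot] at hr
    omega
  obtain ⟨a, ha, hspan⟩ := finrank_eq_one_iff'.1 hr
  have ha0 : (a : V) ≠ 0 := fun h => ha (Subtype.ext h)
  obtain ⟨ψ, hψ⟩ := Projective.exists_dual_eq_one K ha0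
  have hAξ : ∀ v, A v = ψ (A v) • (a : V) := by
    intro v
    obtain ⟨c, hc⟩ := hspan ⟨A v, ⟨v, rfl⟩⟩
    have hc' : c • (a : V) = A v := congrArg Subtype.val hc
    rw [← hc', map_smul, hψ, smul_eq_mul, mul_one]
  -- the functionals `v ↦ ψ (A (x v))` exhaust the dual space
  let Φ : End K V →ₗ[K] Dual K V :=
    LinearMap.mk₂ K (fun x v => ψ (A (x v))) (fun _ _ _ => by simp) (fun _ _ _ => by simp)
      (fun _ _ _ => by simp) (fun _ _ _ => by simp)
  have hΦtop : (W ^ m).map Φ = ⊤ := by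
    rw [← Subspace.dualCoannihilator_dualAnnihilator_eq (W := (W ^ m).map Φ)]
    rw [show ((W ^ m).map Φ).dualCoannihilator = ⊥ from ?_, dualAnnihilator_bot]
    rw [eq_bot_iff]
    intro v hv
    by_contra hv0
    rw [mem_dualCoannihilator] at hv
    obtain ⟨f, hf⟩ := Projective.exists_dual_eq_one K (x := v) (by simpa using hv0)
    obtain ⟨x, hx, hne⟩ := exists_mul_mul_ne_zero hW h1 hA0 (G := f.smulRight v) (by
      intro h
      have := LinearMap.congr_fun h v
      rw [LinearMap.smulRight_apply, hf, one_smul] at this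
      exact hv0 (by simpa using this))
    apply hne
    ext u
    have h2 : ψ (A (x v)) = 0 := hv _ ⟨x, hx, rfl⟩
    have h3 : A (x v) = 0 := by rw [hAξ, h2, zero_smul]
    simp [h3]
  have htop := orbitSpan_pow_eq_top hW h1 (U := span K {(a : V)}) (by simpa using ha0)
  have hmem : ∀ (f : Dual K V) (y : V), f.smulRight y ∈ W ^ (m + k + m) := by
    intro f y
    obtain ⟨x, hx, rfl⟩ : f ∈ (W ^ m).map Φ := hΦtop ▸ mem_top
    have hy : y ∈ orbitSpan (W ^ m) (span K {(a : V)}) := htop ▸ mem_top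
    have hle : orbitSpan (W ^ m) (span K {(a : V)}) ≤
        (W ^ (m + k + m)).comap (LinearMap.smulRightₗ (Φ x)) := by
      refine orbitSpan_le.2 fun z hz u hu => ?_
      obtain ⟨c, rfl⟩ := mem_span_singleton.1 hu
      rw [map_smul, mem_comap, map_smul]
      refine smul_mem _ _ ?_
      have h2 : LinearMap.smulRightₗ (Φ x) (z a) = z * A * x := by
        ext v
        have := hAξ (x v)
        simp only [Module.End.mul_apply]
        rw [this, map_smul]
        rfl
      rw [h2, pow_add, pow_add]
      exact mul_mem_mul (mul_mem_mul hz hA) hx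
    exact hle hy
  rw [eq_top_iff]
  intro z _
  let b := Module.finBasis K V
  have hz : z = ∑ i, (b.coord i).smulRight (z (b i)) := by
    refine b.ext fun j => ?_
    simp [LinearMap.sum_apply, Finsupp.single_apply]
  rw [hz]
  exact sum_mem fun i _ => hmem _ _

/-- An irreducible space of operators containing the identity spans all operators quickly. -/
theorem exists_pow_eq_top [IsAlgClosed K] [Nontrivial V] (hW : ActsIrreducibly W) (h1 : 1 ∈ W) :
    ∃ k : ℕ, W ^ k = ⊤ ∧ (k : ℝ) ≤
      2 * finrank K V * Real.logb 2 (finrank K V) + 4 * finrank K V - 4 := by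
  have hone : (1 : End K V) ∈ W ^ 0 := by
    rw [pow_zero]
    exact Submodule.one_le.1 le_rfl
  obtain ⟨k, A, hA, hr, hk⟩ := exists_endRank_eq_one hW h1 hone one_ne_zero
  refine ⟨_, pow_eq_top_of_endRank_eq_one hW h1 hA hr, ?_⟩
  have hn : 1 ≤ finrank K V := finrank_pos
  have hid : endRank (1 : End K V) = finrank K V := by
    rw [endRank, show LinearMap.range (1 : End K V) = ⊤ from LinearMap.range_id, finrank_top]
  rw [hid] at hk
  push_cast [Nat.cast_sub hn] at hk ⊢
  have : (1 : ℝ) ≤ finrank K V := by exact_mod_cast hn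
  linarith

end RankOne

end MatrixLength

namespace MatrixLength

open Module Submodule

/-! ### Gluing along invariant subspaces. -/

section Reducible

/-- The `+ 1` is the cost of one extension in `StabilizesOn.of_extension`. -/
theorem length_bound_superadditive {a b : ℕ} (ha : 1 ≤ a) (hb : 1 ≤ b) :
    (2 * a * Real.logb 2 a + 4 * a - 4) + (2 * b * Real.logb 2 b + 4 * b - 4) + 1 ≤
      2 * (a + b : ℕ) * Real.logb 2 (a + b : ℕ) + 4 * (a + b : ℕ) - 4 := by
  have ha' : (1 : ℝ) ≤ a := by exact_mod_cast ha
  have hb' : (1 : ℝ) ≤ b := by exact_mod_cast hb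
  have h1 : Real.logb 2 a ≤ Real.logb 2 (a + b : ℕ) :=
    Real.logb_le_logb_of_le (by norm_num) (by linarith) (by push_cast; linarith)
  have h2 : Real.logb 2 b ≤ Real.logb 2 (a + b : ℕ) :=
    Real.logb_le_logb_of_le (by norm_num) (by linarith) (by push_cast; linarith)
  have h3 := mul_le_mul_of_nonneg_left h1 (show (0 : ℝ) ≤ 2 * a by linarith)
  have h4 := mul_le_mul_of_nonneg_left h2 (show (0 : ℝ) ≤ 2 * b by linarith)
  have h5 : ((a + b : ℕ) : ℝ) = a + b := by push_cast; rfl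
  rw [h5] at h3 h4 ⊢
  linarith

variable {K R : Type*} [Field K] [Ring R] [Algebra K R] {W : Submodule K R}

/-- Every element of `W ^ (k + 1)` acts on `V` as some element of `W ^ k`. -/
def StabilizesOn (W : Submodule K R) (k : ℕ) (V : Type*) [AddCommGroup V] [Module R V] : Prop :=
  ∀ x ∈ W ^ (k + 1), ∃ y ∈ W ^ k, ∀ v : V, x • v = y • v

/-- The product `(a - a') (b - b')` acts as zero: `b - b'` maps `V` into `U`, where `a - a'`
vanishes. Expanding it rewrites `a b` by shorter terms. -/
theorem StabilizesOn.of_extension {V : Type*} [AddCommGroup V] [Module R V] (h1 : (1 : R) ∈ W)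
    (U : Submodule R V) {k l : ℕ} (hU : StabilizesOn W k U) (hQ : StabilizesOn W l (V ⧸ U)) :
    StabilizesOn W (k + l + 1) V := by
  intro x hx
  rw [show k + l + 1 + 1 = (k + 1) + (l + 1) by ring, pow_add] at hx
  induction hx using Submodule.mul_induction_on' with
  | mem_mul_mem a ha b hb =>
    obtain ⟨a', ha', haU⟩ := hU a ha
    obtain ⟨b', hb', hbQ⟩ := hQ b hb
    refine ⟨a' * b + a * b' - a' * b', sub_mem (add_mem ?_ ?_) ?_, fun v => ?_⟩
    · rw [add_assoc, pow_add]
      exact mul_mem_mul ha' hb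
    · rw [add_right_comm, pow_add]
      exact mul_mem_mul ha hb'
    · refine pow_mono_of_one_mem h1 (Nat.le_succ (k + l)) ?_
      rw [pow_add]
      exact mul_mem_mul ha' hb'
    · have hmem : b • v - b' • v ∈ U := by
        rw [← Submodule.Quotient.eq]
        exact hbQ (Submodule.Quotient.mk v)
      have h := congrArg Subtype.val (haU ⟨_, hmem⟩)
      simp only [SetLike.val_smul, smul_sub, smul_smul] at h
      rw [sub_smul, add_smul, ← sub_eq_zero]
      rw [← sub_eq_zero] at h
      rw [← h]
      abel
  | add a _ b _ h1 h2 =>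
    obtain ⟨a', ha', h⟩ := h1
    obtain ⟨b', hb', h'⟩ := h2
    exact ⟨a' + b', add_mem ha' hb', fun v => by rw [add_smul, add_smul, h, h']⟩

theorem exists_stabilizesOn_of_isSimpleModule [IsAlgClosed K] {V : Type*} [AddCommGroup V]
    [Module K V] [Module R V] [IsScalarTower K R V] [FiniteDimensional K V]
    (h1 : (1 : R) ∈ W) (hgen : ∀ r : R, ∃ j, r ∈ W ^ j) (hV : IsSimpleModule R V) :
    ∃ k : ℕ, (k : ℝ) ≤ 2 * finrank K V * Real.logb 2 (finrank K V) + 4 * finrank K V - 4 ∧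
      StabilizesOn W k V := by
  let ρ : R →ₐ[K] End K V := Algebra.lsmul K K V
  have hρ : ∀ r v, ρ r v = r • v := fun _ _ => rfl
  have hirr : ActsIrreducibly (W.map ρ.toLinearMap) := by
    intro U hU
    have hpow : ∀ j, ∀ r ∈ W ^ j, ∀ u ∈ U, r • u ∈ U := by
      intro j r hr
      induction hr using Submodule.pow_induction_on_left' with
      | algebraMap c =>
        intro u hu
        rw [algebraMap_smul]
        exact smul_mem _ _ hu
      | add x y i _ _ hx hy =>
        intro u hu
        rw [add_smul]
        exact add_mem (hx u hu) (hy u hu)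
      | mem_mul m hm i x _ hx =>
        intro u hu
        rw [mul_smul]
        exact hU (ρ m) ⟨m, hm, rfl⟩ _ (hx u hu)
    let U' : Submodule R V :=
      { carrier := U
        add_mem' := add_mem
        zero_mem' := zero_mem _
        smul_mem' := fun r u hu => by
          obtain ⟨j, hj⟩ := hgen r
          exact hpow j r hj u hu }
    rcases eq_bot_or_eq_top U' with h | h
    · left
      rw [eq_bot_iff]
      intro u hu
      have : u ∈ U' := hu
      rw [h] at this
      exact this
    · right
      rw [eq_top_iff]
      intro u _
      have : u ∈ U' := h ▸ mem_top
      exact this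
  have : Nontrivial V := IsSimpleModule.nontrivial R V
  obtain ⟨k, hk, hle⟩ := exists_pow_eq_top hirr ⟨1, h1, map_one ρ⟩
  refine ⟨k, hle, fun x _ => ?_⟩
  rw [← Submodule.map_pow] at hk
  obtain ⟨y, hy, hxy⟩ : ρ x ∈ (W ^ k).map ρ.toLinearMap := hk ▸ mem_top
  exact ⟨y, hy, fun v => (LinearMap.congr_fun hxy v).symm⟩

universe v

/-- `W` lives in an abstract algebra so that the same powers act on `U` and on `V ⧸ U`. -/
theorem exists_stabilizesOn [IsAlgClosed K] (h1 : (1 : R) ∈ W) (hgen : ∀ r : R, ∃ j, r ∈ W ^ j)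
    (V : Type v) [AddCommGroup V] [Module K V] [Module R V] [IsScalarTower K R V]
    [FiniteDimensional K V] [Nontrivial V] :
    ∃ k : ℕ, (k : ℝ) ≤ 2 * finrank K V * Real.logb 2 (finrank K V) + 4 * finrank K V - 4 ∧
      StabilizesOn W k V := by
  induction hn : finrank K V using Nat.strong_induction_on generalizing V with
  | _ n ih =>
    subst hn
    by_cases hV : IsSimpleModule R V
    · exact exists_stabilizesOn_of_isSimpleModule h1 hgen hV
    · obtain ⟨U, hbot, htop⟩ : ∃ U : Submodule R V, U ≠ ⊥ ∧ U ≠ ⊤ := by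
        by_contra! h
        exact hV ((isSimpleModule_iff R V).2
          ⟨fun U => or_iff_not_imp_left.2 (h U)⟩)
      have hsum : finrank K (V ⧸ U) + finrank K U = finrank K V :=
        finrank_quotient_add_finrank (U.restrictScalars K)
      have : Nontrivial U := (Submodule.nontrivial_iff_ne_bot).2 hbot
      have : Nontrivial (V ⧸ U) := Submodule.Quotient.nontrivial_iff.2 htop
      have : FiniteDimensional K U :=
        inferInstanceAs (FiniteDimensional K (U.restrictScalars K))
      have : FiniteDimensional K (V ⧸ U) :=
        inferInstanceAs (FiniteDimensional K (V ⧸ U.restrictScalars K))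
      have hU : 1 ≤ finrank K U := finrank_pos
      have hQ : 1 ≤ finrank K (V ⧸ U) := finrank_pos
      obtain ⟨k, hk, hkU⟩ := ih _ (by omega) U rfl
      obtain ⟨l, hl, hlQ⟩ := ih _ (by omega) (V ⧸ U) rfl
      refine ⟨_, ?_, hkU.of_extension h1 U hlQ⟩
      have h := length_bound_superadditive hQ hU
      rw [hsum] at h
      push_cast
      linarith

theorem exists_stabilizes_algHom [IsAlgClosed K] (h1 : (1 : R) ∈ W)
    (hgen : ∀ r : R, ∃ j, r ∈ W ^ j) {V : Type v} [AddCommGroup V] [Module K V]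
    [FiniteDimensional K V] [Nontrivial V] (ρ : R →ₐ[K] End K V) :
    ∃ k : ℕ, (k : ℝ) ≤ 2 * finrank K V * Real.logb 2 (finrank K V) + 4 * finrank K V - 4 ∧
      ∀ x ∈ W ^ (k + 1), ∃ y ∈ W ^ k, ρ x = ρ y := by
  let : Module R V := Module.compHom V ρ.toRingHom
  have hsmul : ∀ (r : R) (v : V), r • v = ρ r v := fun _ _ => rfl
  have : IsScalarTower K R V := ⟨fun c r v => by
    rw [hsmul, hsmul, map_smul, LinearMap.smul_apply]⟩
  obtain ⟨k, hk, hst⟩ := exists_stabilizesOn h1 hgen V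
  refine ⟨k, hk, fun x hx => ?_⟩
  obtain ⟨y, hy, hxy⟩ := hst x hx
  exact ⟨y, hy, LinearMap.ext hxy⟩

end Reducible

/-! ### Words and powers of `W`. -/

section Words

variable {F A : Type*} [Field F] [Ring A] [Algebra F A]

theorem words_subset_pow (S : Set A) {j k : ℕ} (h : j ≤ k) :
    words S j ⊆ (span F (insert 1 S) ^ k : Submodule F A) := by
  have h1 : (1 : A) ∈ span F (insert 1 S) := subset_span (Set.mem_insert 1 S)
  rintro _ ⟨l, hl, hS, rfl⟩
  refine pow_mono_of_one_mem h1 h ?_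
  subst hl
  clear h
  induction l with
  | nil =>
    rw [List.prod_nil, List.length_nil, pow_zero]
    exact Submodule.one_le.1 le_rfl
  | cons a l ih =>
    rw [List.prod_cons, List.length_cons, pow_succ']
    exact mul_mem_mul (subset_span (Set.mem_insert_of_mem 1 (hS a List.mem_cons_self)))
      (ih fun x hx => hS x (List.mem_cons_of_mem a hx))

theorem wordSpan_eq_pow (S : Set A) (k : ℕ) : wordSpan F S k = span F (insert 1 S) ^ k := by
  apply le_antisymm
  · refine span_le.2 ?_
    rintro a ⟨j, hj, ha⟩
    exact words_subset_pow S hj ha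
  · induction k with
    | zero =>
      rw [pow_zero, Submodule.one_le]
      exact subset_span ⟨0, le_rfl, [], rfl, by simp, rfl⟩
    | succ k ih =>
      rw [pow_succ']
      refine (mul_le_mul_right ih _).trans ?_
      rw [wordSpan, Submodule.span_mul_span]
      refine span_le.2 ?_
      rintro _ ⟨a, ha, b, ⟨j, hj, l, hl, hS, rfl⟩, rfl⟩
      rcases ha with rfl | ha
      · refine subset_span ⟨j, by omega, l, hl, hS, ?_⟩
        simp
      · refine subset_span ⟨j + 1, by omega, a :: l, by simp [hl], ?_, by simp⟩
        intro x hx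
        rcases List.mem_cons.1 hx with rfl | hx
        · exact ha
        · exact hS x hx

theorem mem_adjoin_iff_exists_mem_pow (S : Set A) (a : A) :
    a ∈ Algebra.adjoin F S ↔ ∃ k, a ∈ span F (insert 1 S) ^ k := by
  have h1 : (1 : A) ∈ span F (insert 1 S) := subset_span (Set.mem_insert 1 S)
  constructor
  · intro ha
    induction ha using Algebra.adjoin_induction with
    | mem x hx => exact ⟨1, by rw [pow_one]; exact subset_span (Set.mem_insert_of_mem 1 hx)⟩
    | algebraMap c => exact ⟨0, by rw [pow_zero]; exact Submodule.algebraMap_mem c⟩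
    | add x y _ _ hx hy =>
      obtain ⟨i, hi⟩ := hx
      obtain ⟨j, hj⟩ := hy
      exact ⟨max i j, add_mem (pow_mono_of_one_mem h1 (le_max_left i j) hi)
        (pow_mono_of_one_mem h1 (le_max_right i j) hj)⟩
    | mul x y _ _ hx hy =>
      obtain ⟨i, hi⟩ := hx
      obtain ⟨j, hj⟩ := hy
      exact ⟨i + j, by rw [pow_add]; exact mul_mem_mul hi hj⟩
  · rintro ⟨k, hk⟩
    have hle : span F (insert 1 S) ≤ Subalgebra.toSubmodule (Algebra.adjoin F S) := by
      refine span_le.2 (Set.insert_subset (one_mem (Algebra.adjoin F S)) Algebra.subset_adjoin)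
    induction hk using Submodule.pow_induction_on_left' with
    | algebraMap c => exact algebraMap_mem _ c
    | add x y i _ _ hx hy => exact add_mem hx hy
    | mem_mul m hm i x _ hx => exact mul_mem (hle hm) hx

/-- Comparing only two consecutive powers makes the condition testable on a representation and
stable under descent of the field. -/
theorem mem_spanningLengths_iff (S : Set A) (k : ℕ) :
    k ∈ spanningLengths F S ↔ span F (insert 1 S) ^ (k + 1) ≤ span F (insert 1 S) ^ k := by
  have h1 : (1 : A) ∈ span F (insert 1 S) := subset_span (Set.mem_insert 1 S)
  rw [spanningLengths, Set.mem_ofPred_eq, wordSpan_eq_pow]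
  constructor
  · intro h x hx
    rw [h]
    exact (mem_adjoin_iff_exists_mem_pow S x).2 ⟨_, hx⟩
  · intro h
    apply le_antisymm
    · exact fun x hx => (mem_adjoin_iff_exists_mem_pow S x).2 ⟨_, hx⟩
    · intro x hx
      obtain ⟨j, hj⟩ := (mem_adjoin_iff_exists_mem_pow S x).1 hx
      exact pow_le_of_pow_succ_le h1 h j hj

end Words

/-! ### Matrices over an arbitrary field. -/

section Matrices

variable {n : ℕ}

theorem exists_mem_spanningLengths_of_isAlgClosed {K : Type*} [Field K] [IsAlgClosed K]
    (hn : 1 ≤ n) (S : Set (Matrix (Fin n) (Fin n) K)) : ∃ k ∈ spanningLengths K S,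
      (k : ℝ) ≤ 2 * n * Real.logb 2 n + 4 * n - 4 := by
  let R := Algebra.adjoin K S
  let ι : R →ₐ[K] Matrix (Fin n) (Fin n) K := R.val
  let W : Submodule K R := span K (insert 1 {x : R | (x : Matrix (Fin n) (Fin n) K) ∈ S})
  have hW : W.map ι.toLinearMap = span K (insert 1 S) := by
    rw [map_span, Set.image_insert_eq]
    congr 2
    ext a
    constructor
    · rintro ⟨x, hx, rfl⟩
      exact hx
    · exact fun ha => ⟨⟨a, Algebra.subset_adjoin ha⟩, ha, rfl⟩
  have hpow : ∀ k (x : R), (x : Matrix (Fin n) (Fin n) K) ∈ span K (insert 1 S) ^ k → x ∈ W ^ k := by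
    intro k x hx
    rw [← hW, ← Submodule.map_pow] at hx
    obtain ⟨y, hy, hxy⟩ := hx
    have : y = x := Subtype.ext hxy
    exact this ▸ hy
  have hpow' : ∀ k, ∀ x ∈ W ^ k, (x : Matrix (Fin n) (Fin n) K) ∈ span K (insert 1 S) ^ k := by
    intro k x hx
    rw [← hW, ← Submodule.map_pow]
    exact ⟨x, hx, rfl⟩
  let φ : R →ₐ[K] End K (Fin n → K) := Matrix.toLinAlgEquiv'.toAlgHom.comp ι
  have : Nonempty (Fin n) := ⟨⟨0, hn⟩⟩
  obtain ⟨k, hk, hst⟩ := exists_stabilizes_algHom (W := W) (subset_span (Set.mem_insert 1 _))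
    (fun r => by
      obtain ⟨j, hj⟩ := (mem_adjoin_iff_exists_mem_pow S _).1 r.2
      exact ⟨j, hpow j r hj⟩) φ
  rw [finrank_fin_fun] at hk
  refine ⟨k, (mem_spanningLengths_iff S k).2 fun x hx => ?_, hk⟩
  have hxR : x ∈ R := (mem_adjoin_iff_exists_mem_pow S x).2 ⟨_, hx⟩
  obtain ⟨y, hy, hxy⟩ := hst ⟨x, hxR⟩ (hpow (k + 1) _ hx)
  have : x = y := Matrix.toLinAlgEquiv'.injective hxy
  rw [this]
  exact hpow' k y hy

/-- An `F`-linear retraction `π` of `K` onto `F`, applied entrywise, carries the `K`-span back to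
the `F`-span. -/
theorem mem_span_of_map_mem_span {F K : Type*} [Field F] [Field K] [Algebra F K]
    {Y : Set (Matrix (Fin n) (Fin n) F)} {x : Matrix (Fin n) (Fin n) F}
    (hx : (algebraMap F K).mapMatrix x ∈ span K ((algebraMap F K).mapMatrix '' Y)) :
    x ∈ span F Y := by
  obtain ⟨π, hπ⟩ := LinearMap.exists_leftInverse_of_injective (Algebra.linearMap F K)
    (LinearMap.ker_eq_bot.2 (algebraMap F K).injective)
  have hπ' : ∀ a c, π (c * algebraMap F K a) = π c * a := by
    intro a c
    rw [mul_comm, ← Algebra.smul_def, map_smul, smul_eq_mul, mul_comm]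
  -- The scalar `c` is part of the induction because `π` is not `K`-linear.
  have key : ∀ z ∈ span K ((algebraMap F K).mapMatrix '' Y), ∀ c : K,
      (c • z).map π ∈ span F Y := by
    intro z hz
    induction hz using span_induction with
    | mem z hz =>
      obtain ⟨y, hy, rfl⟩ := hz
      intro c
      have : (c • (algebraMap F K).mapMatrix y).map π = π c • y := by
        ext i j
        simp [hπ']
      rw [this]
      exact smul_mem _ _ (subset_span hy)
    | zero =>
      intro c
      rw [smul_zero, show (0 : Matrix (Fin n) (Fin n) K).map π = 0 by ext i j; simp]
      exact zero_mem _
    | add a b _ _ ha hb =>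
      intro c
      rw [smul_add, show (c • a + c • b).map π = (c • a).map π + (c • b).map π by
        ext i j
        simp]
      exact add_mem (ha c) (hb c)
    | smul d z _ hz =>
      intro c
      rw [smul_smul]
      exact hz (c * d)
  have h := key _ hx 1
  rw [one_smul] at h
  have hxx : ((algebraMap F K).mapMatrix x).map π = x := by
    ext i j
    simpa using hπ' (x i j) 1 |>.trans (by
      have := LinearMap.congr_fun hπ 1
      simp at this
      rw [this, one_mul])
  rwa [hxx] at h

open scoped Pointwise in
theorem exists_mem_spanningLengths {F : Type*} [Field F] (hn : 1 ≤ n)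
    (S : Set (Matrix (Fin n) (Fin n) F)) : ∃ k ∈ spanningLengths F S,
      (k : ℝ) ≤ 2 * n * Real.logb 2 n + 4 * n - 4 := by
  let K := AlgebraicClosure F
  let f := (algebraMap F K).mapMatrix (m := Fin n)
  obtain ⟨k, hk, hle⟩ := exists_mem_spanningLengths_of_isAlgClosed hn (f '' S)
  refine ⟨k, (mem_spanningLengths_iff S k).2 ?_, hle⟩
  rw [mem_spanningLengths_iff] at hk
  have himage : ∀ j, span K (insert 1 (f '' S)) ^ j = span K (f '' (insert 1 S) ^ j) := by
    intro j
    rw [span_pow, Set.image_pow, Set.image_insert_eq, map_one]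
  rw [himage, himage] at hk
  rw [span_pow, span_pow]
  refine span_le.2 fun x hx => ?_
  exact mem_span_of_map_mem_span (hk (subset_span ⟨x, hx, rfl⟩))

end Matrices

end MatrixLength

theorem theorem1 :
    (∀ (F : Type u) [Field F] (n : ℕ), 1 ≤ n →
      (∀ S : Set (Matrix (Fin n) (Fin n) F),
        IsLeast (MatrixLength.spanningLengths F S) (MatrixLength.setLength F S) ∧
        (MatrixLength.setLength F S : ℝ) ≤ 2 * n * Real.logb 2 n + 4 * n - 4) ∧
      IsGreatest (MatrixLength.generatingLengths F (Matrix (Fin n) (Fin n) F))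
        (MatrixLength.algLength F (Matrix (Fin n) (Fin n) F)) ∧
      (MatrixLength.algLength F (Matrix (Fin n) (Fin n) F) : ℝ) ≤
        2 * n * Real.logb 2 n + 4 * n - 4) ∧
    (∃ C : ℝ, ∀ (F : Type u) [Field F] (n : ℕ), 2 ≤ n →
      (MatrixLength.algLength F (Matrix (Fin n) (Fin n) F) : ℝ) ≤
        C * (n * Real.log n)) := by
  have main : ∀ (F : Type u) [Field F] (n : ℕ), 1 ≤ n →
      (∀ S : Set (Matrix (Fin n) (Fin n) F),
        IsLeast (MatrixLength.spanningLengths F S) (MatrixLength.setLength F S) ∧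
        (MatrixLength.setLength F S : ℝ) ≤ 2 * n * Real.logb 2 n + 4 * n - 4) ∧
      IsGreatest (MatrixLength.generatingLengths F (Matrix (Fin n) (Fin n) F))
        (MatrixLength.algLength F (Matrix (Fin n) (Fin n) F)) ∧
      (MatrixLength.algLength F (Matrix (Fin n) (Fin n) F) : ℝ) ≤
        2 * n * Real.logb 2 n + 4 * n - 4 := by
    intro F _ n hn
    have hS : ∀ S : Set (Matrix (Fin n) (Fin n) F),
        IsLeast (MatrixLength.spanningLengths F S) (MatrixLength.setLength F S) ∧
        (MatrixLength.setLength F S : ℝ) ≤ 2 * n * Real.logb 2 n + 4 * n - 4 := by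
      intro S
      obtain ⟨k, hk, hle⟩ := MatrixLength.exists_mem_spanningLengths hn S
      -- The witness `k` rules out the default value `sInf ∅ = 0`.
      refine ⟨⟨Nat.sInf_mem ⟨k, hk⟩, fun j hj => Nat.sInf_le hj⟩, le_trans ?_ hle⟩
      exact_mod_cast Nat.sInf_le hk
    have hbound : ∀ m ∈ MatrixLength.generatingLengths F (Matrix (Fin n) (Fin n) F),
        (m : ℝ) ≤ 2 * n * Real.logb 2 n + 4 * n - 4 := by
      rintro _ ⟨S, _, rfl⟩
      exact (hS S).2
    have hbdd : BddAbove (MatrixLength.generatingLengths F (Matrix (Fin n) (Fin n) F)) :=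
      ⟨⌊2 * n * Real.logb 2 n + 4 * n - 4⌋₊, fun m hm => Nat.le_floor (hbound m hm)⟩
    have hmem : MatrixLength.algLength F (Matrix (Fin n) (Fin n) F) ∈
        MatrixLength.generatingLengths F (Matrix (Fin n) (Fin n) F) :=
      -- Nonempty, since the whole algebra generates itself, and bounded, so the supremum is
      -- attained rather than a default value.
      Nat.sSup_mem ⟨_, Set.univ, Algebra.adjoin_univ F _, rfl⟩ hbdd
    exact ⟨hS, ⟨hmem, fun m hm => le_csSup hbdd hm⟩, hbound _ hmem⟩
  -- For `n ≥ 2`, `log₂ n ≥ 1` absorbs `4 n` into `4 n log₂ n`, for a total of `6 n log₂ n`.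
  refine ⟨main, 6 / Real.log 2, fun F _ n hn => ?_⟩
  refine (main F n (by omega)).2.2.trans ?_
  have h2 : 0 < Real.log 2 := Real.log_pos (by norm_num)
  have hn' : (2 : ℝ) ≤ n := by exact_mod_cast hn
  have hlog : 1 ≤ Real.logb 2 n := by
    rw [Real.le_logb_iff_rpow_le (by norm_num) (by linarith), Real.rpow_one]
    exact hn'
  have hC : 6 / Real.log 2 * (n * Real.log n) = 6 * n * Real.logb 2 n := by
    rw [Real.logb]
    ring
  rw [hC]
  nlinarith
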